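/- Let $(\mu_\alpha,c_\alpha)$ be a net where $\mu_\alpha$ is a Borel probability measure on $\mathbb R$, $c_\alpha>0$ and $c_\alpha\to 0$. For $t\in\mathbb R$ put $$\overline L(t)=\limsup_\alpha c_\alpha\log\int_{\mathbb R}e^{c_\alpha^{-1}tx}\,\mu_\alpha(dx)\in[-\infty,+\infty],$$ and say that $L(t)$ exists when this upper limit is a limit (in $[-\infty,+\infty]$). Let $\overline L^*(x)=\sup_{t\in\mathbb R}\{tx-\overline L(t)\}$, where $0\cdot(\pm\infty)=0$ and $\infty-\infty=-\infty$ when $x=\pm\infty$. For $t\ge 0$ let $\overline L'_r(t)\in[-\infty,+\infty]$ be the right derivative of the convex function $\overline L$ at $t$, where $\overline L'_r(t)=+\infty$ if $\overline L(s)=+\infty$ for all $s>t$, and $\overline L'_r(t)=-\infty$ if $\overline L(s)=-\infty$ for some $s>t$. For $\lambda\ge0$ let $\overline L(\lambda^+)$ and $\overline L'_r(\lambda^+)$ be the limits of $\overline L(t)$ and $\overline L'_r(t)$ as $t\downarrow\lambda$, and let $$\tilde\lambda=\sup\{t>\lambda:\overline L_{|]\lambda,t]}\text{ is (real-valued and)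 affine}\},$$ with $\tilde\lambda=\lambda$ if this set is empty. The $\mu_\alpha$ are regarded as measures on $[-\infty,+\infty]$. **Theorem.** Let $\lambda\ge0$. When $\overline L'_r(\lambda^+)>-\infty$, assume that $\overline L'_r(\lambda^+)$ is a limit point (accumulation point in $[-\infty,+\infty]$) of the set $\{\overline L'_r(t):t>\lambda\}$; when $\overline L'_r(\lambda^+)=-\infty$, assume that $\overline L(\lambda)=\overline L(\lambda^+)$ and $\overline L(\lambda)>-\infty$. Then for each net $(x_\alpha,y_\alpha)$ in $[-\infty,+\infty]^2$ such that $x_\alpha\to\overline L'_r(\lambda^+)$ and $\liminf_\alpha y_\alpha>\overline L'_r(\lambda^+)$ we have $$\limsup_\alpha c_\alpha\log\mu_\alpha([x_\alpha,y_\alpha])=\limsup_\alpha c_\alpha\log\mu_\alpha(]x_\alpha,y_\alpha[)=\overline L(\lambda^+)-\lambda\overline L'_r(\lambda^+)$$ (with the convention $0\cdot(-\infty)=0$), and this value equals $$\begin{cases}-\overline L^*(\overline L'_r(\lambda^+))=\inf_{t>0}\{\overline L(t)-t\,\overline L'_r(\lambda^+)\}&\text{if }\overline L'_r(\lambda^+)\ne-\infty,\\[2pt]-\lim_\alpha\overline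 L^*(x_\alpha)=0&\text{if }\overline L'_r(\lambda^+)=-\infty.\end{cases}$$ Furthermore, if $L(t_i)$ exists for all terms of some sequence $(t_i)$ in $]\tilde\lambda,+\infty[$ converging to $\tilde\lambda$, then the two upper limits above are limits. -/

import Mathlib

open Filter Topology MeasureTheory

/-- The scaled log-moment generating function `c log ∫ e^{t z / c} μ(dz)`, as an extended real. -/
noncomputable def scaledLogMgf (μ : Measure ℝ) (c t : ℝ) : EReal :=
  (c : EReal) * ENNReal.log (∫⁻ z, ENNReal.ofReal (Real.exp (c⁻¹ * t * z)) ∂μ)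

/-- The generalized log-moment generating function of a net `(μ_α, c_α)`:
`t ↦ limsup_α c_α log ∫ e^{t z / c_α} μ_α(dz)`. -/
noncomputable def genLogMgf {ι : Type*} [Preorder ι] (μ : ι → Measure ℝ) (c : ι → ℝ) (t : ℝ) :
    EReal :=
  limsup (fun α => scaledLogMgf (μ α) (c α) t) atTop

open scoped Classical in
/-- The right derivative at `t` of an extended-real-valued function, with the conventions that it is
`+∞` when `f` is identically `+∞` on `]t, +∞[`, and `-∞` when `f` takes the value `-∞` somewhere
on `]t, +∞[`. For the generalized log-moment generating function and `t ≥ 0` the difference quotient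
in the remaining case has a finite `f t` and, by convexity, a limit in `[-∞, +∞]`. -/
noncomputable def extRightDeriv (f : ℝ → EReal) (t : ℝ) : EReal :=
  if ∀ s, t < s → f s = ⊤ then ⊤
  else if ∃ s, t < s ∧ f s = ⊥ then ⊥
  else limUnder (𝓝[>] t) (fun s : ℝ => (f s - f t) / ((s - t : ℝ) : EReal))

/-- The Legendre-Fenchel transform `x ↦ sup_{t ∈ ℝ} (t x - f t)`. It is extended to `x = ±∞` by
the conventions `0 * (±∞) = 0` and `∞ - ∞ = -∞` of extended-real arithmetic. -/
noncomputable def legendreFenchel (f : ℝ → EReal) (x : EReal) : EReal :=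
  ⨆ t : ℝ, ((t : EReal) * x - f t)

/-- `f` is (finite and) affine on the set `s`. -/
def IsAffineOn (f : ℝ → EReal) (s : Set ℝ) : Prop :=
  ∃ a b : ℝ, ∀ t ∈ s, f t = ((a * t + b : ℝ) : EReal)

/-- `sup {t > l : f is affine on ]l, t]}`, the supremum being `l` when there is no such `t`. -/
noncomputable def affineSup (f : ℝ → EReal) (l : ℝ) : EReal :=
  max (l : EReal) (⨆ t ∈ {t : ℝ | l < t ∧ IsAffineOn f (Set.Ioc l t)}, (t : EReal))

/-- `c log μ([a, b])` for `a, b ∈ [-∞, +∞]`, where `μ` is regarded as a measure on `[-∞, +∞]`. -/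
noncomputable def scaledLogIcc (μ : Measure ℝ) (c : ℝ) (a b : EReal) : EReal :=
  (c : EReal) * ENNReal.log (μ (Real.toEReal ⁻¹' Set.Icc a b))

/-- `c log μ(]a, b[)` for `a, b ∈ [-∞, +∞]`, where `μ` is regarded as a measure on `[-∞, +∞]`. -/
noncomputable def scaledLogIoo (μ : Measure ℝ) (c : ℝ) (a b : EReal) : EReal :=
  (c : EReal) * ENNReal.log (μ (Real.toEReal ⁻¹' Set.Ioo a b))

/-! ### Logarithms scaled by a positive constant -/

/-! Write `L` for the generating function and `D` for the limit of its right derivative at `l⁺`. By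
Hölder, `L` is convex, and the hypotheses force it to be proper with a finite value somewhere to the
right of `l` (`IsProperConvex.of_rightLim`); hence `D < ⊤`.

Suppose `D = d` is real. Then `L t - t d` decreases to its global infimum `V` as `t ↓ l`, which
gives the Legendre transform. The upper bound `V` is Chernoff's inequality as `t ↓ l`. For the lower
bound, tilt `μ α` by `e^{tz/c}` with `t` just to the right of `affineSup L l`. Comparing moments of
orders `p < t < s`, the tilted mass outside `]a, b[` is negligible once the chord of `L` over `[p,
t]` has slope above `a` and the chord over `[t, s]` has slope below `b`; so `μ α (]a, b[)` is at
least about `e^{(L t - t b)/c}`. Some `a > d` is allowed because `L` is not affine on `]l, t]`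
(`exists_lt_slope`), and `b = d + ε` is allowed because right derivatives accumulate at `d`
(`exists_affineSup_lt`). No differentiability is needed.

If `D = ⊥`, then `L = ⊤` to the left of `l`, so `l = 0` and the value is `0`: the upper bound is
trivial and the same tilting gives the lower one.

Each lower bound uses near-maximality of the moment at a single order `t`. This holds frequently,
and eventually when the limit exists at `t`; hence the statements about upper limits and limits. -/

theorem strictMono_coe_mul_log {c : ℝ} (hc : 0 < c) :
    StrictMono fun m : ENNReal => (c : EReal) * ENNReal.log m := by
  intro m n hmn
  have h : StrictMono fun e : EReal => e / ((c⁻¹ : ℝ) : EReal) :=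
    EReal.strictMono_div_right_of_pos (by exact_mod_cast inv_pos.2 hc) (EReal.coe_ne_top _)
  have h2 := h (ENNReal.log_strictMono hmn)
  simp only [EReal.div_eq_inv_mul, ← EReal.coe_inv, inv_inv] at h2
  exact h2

theorem coe_mul_log_ofReal_exp {c : ℝ} (hc : 0 < c) (A : ℝ) :
    (c : EReal) * ENNReal.log (ENNReal.ofReal (Real.exp (c⁻¹ * A))) = A := by
  rw [ENNReal.log_ofReal_of_pos (Real.exp_pos _), Real.log_exp, ← EReal.coe_mul,
    mul_inv_cancel_left₀ hc.ne']

theorem coe_mul_log_le_coe_iff {c : ℝ} (hc : 0 < c) {m : ENNReal} {A : ℝ} :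
    (c : EReal) * ENNReal.log m ≤ A ↔ m ≤ ENNReal.ofReal (Real.exp (c⁻¹ * A)) := by
  conv_lhs => rw [← coe_mul_log_ofReal_exp hc A]
  exact (strictMono_coe_mul_log hc).le_iff_le

theorem coe_le_coe_mul_log_iff {c : ℝ} (hc : 0 < c) {m : ENNReal} {A : ℝ} :
    (A : EReal) ≤ (c : EReal) * ENNReal.log m ↔ ENNReal.ofReal (Real.exp (c⁻¹ * A)) ≤ m := by
  conv_lhs => rw [← coe_mul_log_ofReal_exp hc A]
  exact (strictMono_coe_mul_log hc).le_iff_le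

/-! ### Log-moment generating functions -/

theorem scaledLogMgf_zero (μ : Measure ℝ) [IsProbabilityMeasure μ] (c : ℝ) :
    scaledLogMgf μ c 0 = 0 := by
  simp [scaledLogMgf]

/-- Hölder's inequality. Real bounds `A`, `B` replace the values themselves so that `∞ - ∞` never
arises. -/
theorem scaledLogMgf_combo_le (μ : Measure ℝ) {c : ℝ} (hc : 0 < c) {t s p q A B : ℝ}
    (hp : 0 ≤ p) (hq : 0 ≤ q) (hpq : p + q = 1)
    (hA : scaledLogMgf μ c t ≤ A) (hB : scaledLogMgf μ c s ≤ B) :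
    scaledLogMgf μ c (p * t + q * s) ≤ ((p * A + q * B : ℝ) : EReal) := by
  unfold scaledLogMgf at *
  rw [coe_mul_log_le_coe_iff hc] at *
  have key := ENNReal.lintegral_mul_norm_pow_le (μ := μ)
    (f := fun z => ENNReal.ofReal (Real.exp (c⁻¹ * t * z)))
    (g := fun z => ENNReal.ofReal (Real.exp (c⁻¹ * s * z)))
    (by fun_prop) (by fun_prop) hp hq hpq
  calc ∫⁻ z, ENNReal.ofReal (Real.exp (c⁻¹ * (p * t + q * s) * z)) ∂μ
      = ∫⁻ z, ENNReal.ofReal (Real.exp (c⁻¹ * t * z)) ^ p *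
          ENNReal.ofReal (Real.exp (c⁻¹ * s * z)) ^ q ∂μ := by
        refine lintegral_congr fun z => ?_
        rw [ENNReal.ofReal_rpow_of_pos (Real.exp_pos _), ENNReal.ofReal_rpow_of_pos (Real.exp_pos _),
          ← Real.exp_mul, ← Real.exp_mul, ← ENNReal.ofReal_mul (Real.exp_pos _).le, ← Real.exp_add]
        ring_nf
    _ ≤ _ := key
    _ ≤ ENNReal.ofReal (Real.exp (c⁻¹ * A)) ^ p * ENNReal.ofReal (Real.exp (c⁻¹ * B)) ^ q :=
        mul_le_mul' (ENNReal.rpow_le_rpow hA hp) (ENNReal.rpow_le_rpow hB hq)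
    _ = _ := by
        rw [ENNReal.ofReal_rpow_of_pos (Real.exp_pos _), ENNReal.ofReal_rpow_of_pos (Real.exp_pos _),
          ← Real.exp_mul, ← Real.exp_mul, ← ENNReal.ofReal_mul (Real.exp_pos _).le, ← Real.exp_add]
        ring_nf

section Net

variable {ι : Type*} [Preorder ι] {μ : ι → Measure ℝ} {c : ι → ℝ}

theorem eventually_scaledLogMgf_le {t A : ℝ} (h : genLogMgf μ c t < A) :
    ∀ᶠ α in atTop, scaledLogMgf (μ α) (c α) t ≤ A :=
  (eventually_lt_of_limsup_lt h).mono fun _ h => h.le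

theorem genLogMgf_zero [IsDirectedOrder ι] [Nonempty ι] (hμ : ∀ α, IsProbabilityMeasure (μ α)) :
    genLogMgf μ c 0 = 0 := by
  simp [genLogMgf, scaledLogMgf_zero]

theorem genLogMgf_combo_le (hc : ∀ α, 0 < c α) {t s p q A B : ℝ}
    (hp : 0 ≤ p) (hq : 0 ≤ q) (hpq : p + q = 1)
    (hA : genLogMgf μ c t < A) (hB : genLogMgf μ c s < B) :
    genLogMgf μ c (p * t + q * s) ≤ ((p * A + q * B : ℝ) : EReal) := by
  refine limsup_le_of_le (by isBoundedDefault) ?_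
  filter_upwards [eventually_scaledLogMgf_le hA, eventually_scaledLogMgf_le hB] with α h1 h2
  exact scaledLogMgf_combo_le _ (hc α) hp hq hpq h1 h2

end Net

/-! ### Chernoff bounds -/

/-- On `S` the integrand of order `t` is pointwise at most the constant times the one of order `s`.
The sign condition covers right tails (`s > t`) and left tails (`s < t`) at once; `t = 0` gives
Chernoff. -/
theorem lintegral_exp_tail_le (μ : Measure ℝ) (S : Set ℝ) {c t s b : ℝ}
    (h : ∀ z ∈ S, c⁻¹ * ((s - t) * (z - b)) ≥ 0) :
    ∫⁻ z in S, ENNReal.ofReal (Real.exp (c⁻¹ * t * z)) ∂μ ≤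
      ENNReal.ofReal (Real.exp (-(c⁻¹ * ((s - t) * b)))) *
        ∫⁻ z, ENNReal.ofReal (Real.exp (c⁻¹ * s * z)) ∂μ := by
  rw [← lintegral_const_mul _ (by fun_prop)]
  refine (setLIntegral_mono (by fun_prop) fun z hz => ?_).trans (setLIntegral_le_lintegral _ _)
  rw [← ENNReal.ofReal_mul (Real.exp_pos _).le, ← Real.exp_add]
  refine ENNReal.ofReal_le_ofReal (Real.exp_le_exp.2 ?_)
  have := h z hz
  nlinarith

/-- Chernoff's bound for a set contained in `[a, +∞[`. -/
theorem coe_mul_log_measure_le (μ : Measure ℝ) {c : ℝ} (hc : 0 < c) {t a A : ℝ} (ht : 0 ≤ t)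
    {S : Set ℝ} (hS : S ⊆ Set.Ici a) (hA : scaledLogMgf μ c t ≤ A) :
    (c : EReal) * ENNReal.log (μ S) ≤ ((A - t * a : ℝ) : EReal) := by
  unfold scaledLogMgf at hA
  rw [coe_mul_log_le_coe_iff hc] at *
  have h1 := lintegral_exp_tail_le μ (Set.Ici a) (c := c) (t := 0) (s := t) (b := a)
    (fun z hz => mul_nonneg (inv_pos.2 hc).le (mul_nonneg (by linarith) (sub_nonneg.2 hz)))
  simp only [mul_zero, zero_mul, Real.exp_zero, ENNReal.ofReal_one, lintegral_one,
    Measure.restrict_apply_univ, sub_zero] at h1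
  refine (measure_mono hS).trans (h1.trans ?_)
  refine (mul_le_mul' le_rfl hA).trans_eq ?_
  rw [← ENNReal.ofReal_mul (Real.exp_pos _).le, ← Real.exp_add]
  ring_nf

/-- If the exponential moment of order `t` dominates suitably those of orders `r < t < s`, then
`μ` charges `]a, b[`. -/
theorem le_coe_mul_log_measure_Ioo (μ : Measure ℝ) [IsProbabilityMeasure μ] {c δ : ℝ} (hc : 0 < c)
    (hδ : c ≤ δ) {r t s a b A P B : ℝ} (hrt : r < t) (hts : t < s) (ht : 0 ≤ t)
    (hA : scaledLogMgf μ c r ≤ A) (hB : scaledLogMgf μ c s ≤ B)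
    (hP : (P : EReal) ≤ scaledLogMgf μ c t)
    (ha : A + (t - r) * a ≤ P - 2 * δ) (hb : B - (s - t) * b ≤ P - 2 * δ) :
    ((P - δ - t * b : ℝ) : EReal) ≤ (c : EReal) * ENNReal.log (μ (Set.Ioo a b)) := by
  unfold scaledLogMgf at *
  rw [coe_mul_log_le_coe_iff hc] at hA hB
  rw [coe_le_coe_mul_log_iff hc] at *
  have hci := inv_pos.2 hc
  set f : ℝ → ENNReal := fun z => ENNReal.ofReal (Real.exp (c⁻¹ * t * z)) with hf
  have tail1 : ∫⁻ z in Set.Iic a, f z ∂μ ≤ ENNReal.ofReal (Real.exp (c⁻¹ * (P - 2 * δ))) := by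
    refine (lintegral_exp_tail_le μ (Set.Iic a) (s := r) (b := a) ?_).trans ?_
    · intro z hz
      exact mul_nonneg hci.le (mul_nonneg_of_nonpos_of_nonpos (by linarith) (sub_nonpos.2 hz))
    · refine (mul_le_mul' le_rfl hA).trans ?_
      rw [← ENNReal.ofReal_mul (Real.exp_pos _).le, ← Real.exp_add]
      refine ENNReal.ofReal_le_ofReal (Real.exp_le_exp.2 ?_)
      have := mul_le_mul_of_nonneg_left ha hci.le
      nlinarith
  have tail2 : ∫⁻ z in Set.Ici b, f z ∂μ ≤ ENNReal.ofReal (Real.exp (c⁻¹ * (P - 2 * δ))) := by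
    refine (lintegral_exp_tail_le μ (Set.Ici b) (s := s) (b := b) ?_).trans ?_
    · intro z hz
      exact mul_nonneg hci.le (mul_nonneg (by linarith) (sub_nonneg.2 hz))
    · refine (mul_le_mul' le_rfl hB).trans ?_
      rw [← ENNReal.ofReal_mul (Real.exp_pos _).le, ← Real.exp_add]
      refine ENNReal.ofReal_le_ofReal (Real.exp_le_exp.2 ?_)
      have := mul_le_mul_of_nonneg_left hb hci.le
      nlinarith
  have mid : ∫⁻ z in Set.Ioo a b, f z ∂μ ≤
      ENNReal.ofReal (Real.exp (c⁻¹ * (t * b))) * μ (Set.Ioo a b) := by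
    rw [← setLIntegral_const]
    refine setLIntegral_mono (by fun_prop) fun z hz => ?_
    refine ENNReal.ofReal_le_ofReal (Real.exp_le_exp.2 ?_)
    rw [mul_assoc]
    exact mul_le_mul_of_nonneg_left (mul_le_mul_of_nonneg_left hz.2.le ht) hci.le
  have total : ∫⁻ z, f z ∂μ ≤ ∫⁻ z in Set.Iic a, f z ∂μ + ∫⁻ z in Set.Ici b, f z ∂μ +
      ∫⁻ z in Set.Ioo a b, f z ∂μ := by
    have hcov : (Set.univ : Set ℝ) ⊆ (Set.Iic a ∪ Set.Ici b) ∪ Set.Ioo a b := by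
      intro z _
      by_cases h1 : z ≤ a
      · exact Or.inl (Or.inl h1)
      · by_cases h2 : b ≤ z
        · exact Or.inl (Or.inr h2)
        · exact Or.inr ⟨not_le.1 h1, not_le.1 h2⟩
    rw [← setLIntegral_univ]
    refine (lintegral_mono_set hcov).trans ((lintegral_union_le _ _ _).trans ?_)
    gcongr
    exact lintegral_union_le _ _ _
  have key := hP.trans (total.trans (add_le_add (add_le_add tail1 tail2) mid))
  have hfin : μ (Set.Ioo a b) ≠ ⊤ := measure_ne_top _ _
  rw [← ENNReal.ofReal_toReal hfin] at key ⊢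
  set m := (μ (Set.Ioo a b)).toReal with hm
  have hm0 : 0 ≤ m := ENNReal.toReal_nonneg
  rw [← ENNReal.ofReal_mul (Real.exp_pos _).le, ← ENNReal.ofReal_add (Real.exp_pos _).le
    (Real.exp_pos _).le, ← ENNReal.ofReal_add (by positivity) (by positivity),
    ENNReal.ofReal_le_ofReal_iff (by positivity)] at key
  refine ENNReal.ofReal_le_ofReal ?_
  have e1 : Real.exp (c⁻¹ * (P - 2 * δ)) = Real.exp (c⁻¹ * P) * Real.exp (-(c⁻¹ * δ)) ^ 2 := by
    rw [← Real.exp_nat_mul, ← Real.exp_add]; push_cast; ring_nf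
  have e2 : Real.exp (c⁻¹ * (P - δ - t * b)) =
      Real.exp (c⁻¹ * P) * Real.exp (-(c⁻¹ * δ)) / Real.exp (c⁻¹ * (t * b)) := by
    rw [← Real.exp_add, ← Real.exp_sub]; ring_nf
  -- With `q = e^{-δ/c} ≤ 1/2`, the two tails take a fraction at most `2q²` of `e^{P/c}`, and `q +
  -- 2q² ≤ 1` leaves at least `q` for the middle.
  have hq : Real.exp (-(c⁻¹ * δ)) ≤ 1 / 2 := by
    have h1 : 1 ≤ c⁻¹ * δ := by rw [inv_mul_eq_div, le_div_iff₀ hc]; linarith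
    have h2 : 2 ≤ Real.exp (c⁻¹ * δ) := by linarith [Real.add_one_le_exp (c⁻¹ * δ)]
    rw [Real.exp_neg, one_div]
    exact inv_anti₀ two_pos h2
  rw [e2, div_le_iff₀ (Real.exp_pos _)]
  rw [e1] at key
  set q := Real.exp (-(c⁻¹ * δ))
  have hq0 : 0 < q := Real.exp_pos _
  have hE : 0 < Real.exp (c⁻¹ * P) := Real.exp_pos _
  have : Real.exp (c⁻¹ * P) * (q + 2 * q ^ 2) ≤ Real.exp (c⁻¹ * P) * 1 :=
    mul_le_mul_of_nonneg_left (by nlinarith) hE.le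
  nlinarith

/-! ### Eventual bounds along the net -/

section Net

variable {ι : Type*} [Preorder ι] {μ : ι → Measure ℝ} {c : ι → ℝ}

/-- The large deviation lower bound near a point where the generating function has distinct
slopes on both sides. -/
theorem eventually_le_scaledLogIoo (hμ : ∀ α, IsProbabilityMeasure (μ α)) (hc_pos : ∀ α, 0 < c α)
    (hc : Tendsto c atTop (𝓝 0)) {D : EReal} {x y : ι → EReal} (hx : Tendsto x atTop (𝓝 D))
    {r t s a b A P B v : ℝ} (hrt : r < t) (hts : t < s) (ht : 0 ≤ t)
    (hA : genLogMgf μ c r = A) (hB : genLogMgf μ c s = B)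
    (hDa : D < a) (hby : (b : EReal) < liminf y atTop)
    (ha : A + (t - r) * a < P) (hb : B - (s - t) * b < P) (hv : v < P - t * b) :
    ∃ δ > 0, ∀ᶠ α in atTop, ((P - δ : ℝ) : EReal) ≤ scaledLogMgf (μ α) (c α) t →
      (v : EReal) ≤ scaledLogIoo (μ α) (c α) (x α) (y α) := by
  -- Of the `4δ`, one pays for replacing `A` or `B` by an eventual bound, one for replacing `P` by
  -- `P - δ`, and two are the gap required by `le_coe_mul_log_measure_Ioo`.
  obtain ⟨δ, hδ, h1, h2, h3⟩ : ∃ δ > 0, A + (t - r) * a ≤ P - 4 * δ ∧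
      B - (s - t) * b ≤ P - 4 * δ ∧ v ≤ P - t * b - 2 * δ := by
    refine ⟨min (min (P - (A + (t - r) * a)) (P - (B - (s - t) * b))) (P - t * b - v) / 4,
      by have := lt_min (lt_min (sub_pos.2 ha) (sub_pos.2 hb)) (sub_pos.2 hv); positivity, ?_⟩
    have i1 := min_le_left (min (P - (A + (t - r) * a)) (P - (B - (s - t) * b))) (P - t * b - v)
    have i2 := min_le_right (min (P - (A + (t - r) * a)) (P - (B - (s - t) * b))) (P - t * b - v)
    have i3 := min_le_left (P - (A + (t - r) * a)) (P - (B - (s - t) * b))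
    have i4 := min_le_right (P - (A + (t - r) * a)) (P - (B - (s - t) * b))
    have := lt_min (lt_min (sub_pos.2 ha) (sub_pos.2 hb)) (sub_pos.2 hv)
    refine ⟨by linarith, by linarith, by linarith⟩
  refine ⟨δ, hδ, ?_⟩
  have eA : genLogMgf μ c r < ((A + δ : ℝ) : EReal) := by
    rw [hA]; exact_mod_cast lt_add_of_pos_right A hδ
  have eB : genLogMgf μ c s < ((B + δ : ℝ) : EReal) := by
    rw [hB]; exact_mod_cast lt_add_of_pos_right B hδ
  filter_upwards [eventually_scaledLogMgf_le eA, eventually_scaledLogMgf_le eB,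
    hx.eventually (gt_mem_nhds hDa), eventually_lt_of_lt_liminf hby,
    hc.eventually (gt_mem_nhds hδ)] with α kA kB kx ky kc kP
  have := hμ α
  refine le_trans ?_ ((le_coe_mul_log_measure_Ioo (μ α) (hc_pos α) kc.le hrt hts ht kA kB kP
    (a := a) (b := b) (by linarith) (by linarith)).trans ?_)
  · exact_mod_cast (by linarith : v ≤ P - δ - δ - t * b)
  · refine (strictMono_coe_mul_log (hc_pos α)).monotone (measure_mono fun z hz => ?_)
    exact ⟨kx.trans (by exact_mod_cast hz.1), lt_trans (by exact_mod_cast hz.2) ky⟩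

theorem scaledLogIoo_le_scaledLogIcc (μ : Measure ℝ) {c : ℝ} (hc : 0 < c) (a b : EReal) :
    scaledLogIoo μ c a b ≤ scaledLogIcc μ c a b :=
  (strictMono_coe_mul_log hc).monotone (measure_mono (Set.preimage_mono Set.Ioo_subset_Icc_self))

theorem scaledLogIcc_nonpos (μ : Measure ℝ) [IsProbabilityMeasure μ] {c : ℝ} (hc : 0 < c)
    (a b : EReal) : scaledLogIcc μ c a b ≤ 0 := by
  have := (strictMono_coe_mul_log hc).monotone
    (prob_le_one (μ := μ) (s := Real.toEReal ⁻¹' Set.Icc a b))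
  simpa [scaledLogIcc] using this

theorem eventually_scaledLogIcc_le (hc_pos : ∀ α, 0 < c α) {x y : ι → EReal} {t a A v : ℝ}
    (ht : 0 ≤ t) (hA : genLogMgf μ c t = A) {D : EReal} (hx : Tendsto x atTop (𝓝 D))
    (haD : (a : EReal) < D) (hv : A - t * a < v) :
    ∀ᶠ α in atTop, scaledLogIcc (μ α) (c α) (x α) (y α) ≤ v := by
  have h : genLogMgf μ c t < ((v + t * a : ℝ) : EReal) := by
    rw [hA]; exact_mod_cast (by linarith : A < v + t * a)
  filter_upwards [eventually_scaledLogMgf_le h, hx.eventually (lt_mem_nhds haD)] with α h1 h2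
  refine (coe_mul_log_measure_le (μ α) (hc_pos α) ht (a := a) (fun z hz => ?_) h1).trans_eq ?_
  · have : (a : EReal) ≤ z := h2.le.trans hz.1
    exact_mod_cast this
  · simp

end Net

/-! ### Convex extended-real-valued functions -/

/-- Convexity of an extended-real-valued function, in terms of its strict epigraph. -/
def EConvex (f : ℝ → EReal) : Prop :=
  ∀ ⦃t s p q A B : ℝ⦄, 0 ≤ p → 0 ≤ q → p + q = 1 → f t < A → f s < B →
    f (p * t + q * s) ≤ ((p * A + q * B : ℝ) : EReal)

theorem exists_combo_eq {u r s : ℝ} (h1 : u < s) (h2 : s < r) :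
    ∃ p q : ℝ, 0 < p ∧ 0 < q ∧ p + q = 1 ∧ p * u + q * r = s := by
  have h : 0 < r - u := by linarith
  refine ⟨(r - s) / (r - u), (s - u) / (r - u), div_pos (by linarith) h, div_pos (by linarith) h,
    ?_, ?_⟩ <;> field_simp <;> ring

/-- At `u` the bound `A` may be sent to `-∞` while `B` stays fixed. -/
theorem EConvex.eq_bot_of_combo {f : ℝ → EReal} (hf : EConvex f) {u r p q : ℝ} (hp : 0 < p)
    (hq : 0 < q) (hpq : p + q = 1) (hu : f u = ⊥) (hr : f r ≠ ⊤) : f (p * u + q * r) = ⊥ := by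
  obtain ⟨B, hB, -⟩ := EReal.lt_iff_exists_real_btwn.1 (lt_top_iff_ne_top.2 hr)
  rw [EReal.eq_bot_iff_forall_lt]
  intro M
  have h := hf hp.le hq.le hpq (A := (M - 1 - q * B) / p) (by rw [hu]; exact EReal.bot_lt_coe _) hB
  refine h.trans_lt ?_
  rw [mul_div_cancel₀ _ hp.ne']
  exact_mod_cast (by linarith : M - 1 - q * B + q * B < M)

theorem EConvex.eq_bot_of_lt {f : ℝ → EReal} (hf : EConvex f) {u r s : ℝ} (hus : u < s)
    (hsr : s < r) (hu : f u = ⊥) (hr : f r ≠ ⊤) : f s = ⊥ := by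
  obtain ⟨p, q, hp, hq, hpq, rfl⟩ := exists_combo_eq hus hsr
  exact hf.eq_bot_of_combo hp hq hpq hu hr

theorem EConvex.eq_bot_of_gt {f : ℝ → EReal} (hf : EConvex f) {u r s : ℝ} (hus : s < u)
    (hsr : r < s) (hu : f u = ⊥) (hr : f r ≠ ⊤) : f s = ⊥ := by
  obtain ⟨p, q, hp, hq, hpq, rfl⟩ := exists_combo_eq hsr hus
  rw [add_comm]
  exact hf.eq_bot_of_combo hq hp (by linarith) hu hr

/-- A convex function that never takes the value `-∞` and vanishes at `0`. -/
structure IsProperConvex (f : ℝ → EReal) : Prop where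
  convex : EConvex f
  ne_bot : ∀ t, f t ≠ ⊥
  zero : f 0 = 0

/-- The set where `f` is not `+∞`. -/
def effDom (f : ℝ → EReal) : Set ℝ := {t | f t ≠ ⊤}

/-- The right derivative of the real-valued function underlying `f`. -/
noncomputable def realRightDeriv (f : ℝ → EReal) (t : ℝ) : ℝ :=
  derivWithin (fun s => (f s).toReal) (Set.Ioi t) t

namespace IsProperConvex

variable {f : ℝ → EReal} (hf : IsProperConvex f)
include hf

theorem coe_toReal {t : ℝ} (ht : t ∈ effDom f) : (((f t).toReal : ℝ) : EReal) = f t :=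
  EReal.coe_toReal ht (hf.ne_bot t)

theorem zero_mem : (0 : ℝ) ∈ effDom f := by simp [effDom, hf.zero]

theorem convexOn : ConvexOn ℝ (effDom f) fun t => (f t).toReal := by
  have key : ∀ ⦃t⦄, t ∈ effDom f → ∀ ⦃s⦄, s ∈ effDom f → ∀ ⦃p q : ℝ⦄, 0 ≤ p → 0 ≤ q → p + q = 1 →
      ∀ ε > 0, f (p * t + q * s) ≤ ((p * (f t).toReal + q * (f s).toReal + ε : ℝ) : EReal) := by
    intro t ht s hs p q hp hq hpq ε hε
    have h := hf.convex hp hq hpq (t := t) (s := s) (A := (f t).toReal + ε) (B := (f s).toReal + ε)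
      (by rw [← hf.coe_toReal ht, EReal.toReal_coe]; exact_mod_cast lt_add_of_pos_right _ hε)
      (by rw [← hf.coe_toReal hs, EReal.toReal_coe]; exact_mod_cast lt_add_of_pos_right _ hε)
    refine h.trans (EReal.coe_le_coe_iff.2 ?_)
    have : ε = p * ε + q * ε := by rw [← add_mul, hpq, one_mul]
    linarith
  have hconv : Convex ℝ (effDom f) := by
    intro t ht s hs p q hp hq hpq
    exact ne_top_of_le_ne_top (EReal.coe_ne_top _) (key ht hs hp hq hpq 1 one_pos)
  refine ⟨hconv, fun t ht s hs p q hp hq hpq => le_of_forall_pos_le_add fun ε hε => ?_⟩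
  have h := key ht hs hp hq hpq ε hε
  have hm : p * t + q * s ∈ effDom f := hconv ht hs hp hq hpq
  rw [← hf.coe_toReal hm] at h
  exact EReal.coe_le_coe_iff.1 h

theorem mem_interior {u t s : ℝ} (hu : u ∈ effDom f) (hs : s ∈ effDom f) (hut : u < t)
    (hts : t < s) : t ∈ interior (effDom f) := by
  rw [mem_interior_iff_mem_nhds]
  filter_upwards [Ioo_mem_nhds hut hts] with z hz
  exact hf.convexOn.1.ordConnected.out hu hs ⟨hz.1.le, hz.2.le⟩

theorem mem_interior_of_pos {t s : ℝ} (hs : s ∈ effDom f) (ht : 0 < t) (hts : t < s) :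
    t ∈ interior (effDom f) :=
  hf.mem_interior hf.zero_mem hs ht hts

/-- Chords ending at `s` from the left have slope at most the left derivative, hence at most the
right derivative; chords to the right have slope at least the right derivative. -/
theorem support_line {s t : ℝ} (hs : s ∈ interior (effDom f)) (ht : t ∈ effDom f) :
    (f s).toReal + realRightDeriv f s * (t - s) ≤ (f t).toReal := by
  rcases lt_trichotomy t s with h | rfl | h
  · have h1 := (hf.convexOn.slope_le_leftDeriv_of_mem_interior ht hs h).trans
      (hf.convexOn.leftDeriv_le_rightDeriv_of_mem_interior hs)
    rw [slope_def_field, div_le_iff₀ (by linarith)] at h1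
    change _ ≤ realRightDeriv f s * (s - t) at h1
    linarith
  · simp
  · have h1 := hf.convexOn.rightDeriv_le_slope_of_mem_interior hs ht h
    rw [slope_def_field, le_div_iff₀ (by linarith)] at h1
    change realRightDeriv f s * (t - s) ≤ _ at h1
    linarith

theorem realRightDeriv_mono {s t : ℝ} (hs : s ∈ interior (effDom f))
    (ht : t ∈ interior (effDom f)) (hst : s ≤ t) : realRightDeriv f s ≤ realRightDeriv f t :=
  hf.convexOn.monotoneOn_rightDeriv hs ht hst

theorem tendsto_slope {t : ℝ} (ht : t ∈ interior (effDom f)) :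
    Tendsto (slope (fun s => (f s).toReal) t) (𝓝[>] t) (𝓝 (realRightDeriv f t)) := by
  have h := hf.convexOn.hasDerivWithinAt_rightDeriv_of_mem_interior ht
  rwa [hasDerivWithinAt_iff_tendsto_slope' (by simp)] at h

theorem exists_slope_lt {t b : ℝ} (ht : t ∈ interior (effDom f)) (hb : realRightDeriv f t < b) :
    ∃ s > t, s ∈ effDom f ∧ (f s).toReal - (s - t) * b < (f t).toReal := by
  have h1 := (hf.tendsto_slope ht).eventually (gt_mem_nhds hb)
  have h2 : ∀ᶠ s in 𝓝[>] t, s ∈ effDom f :=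
    nhdsWithin_le_nhds (mem_interior_iff_mem_nhds.1 ht)
  obtain ⟨s, ⟨h1, h2⟩, h3⟩ := ((h1.and h2).and self_mem_nhdsWithin).exists
  refine ⟨s, h3, h2, ?_⟩
  have h3 : t < s := h3
  rw [slope_def_field, div_lt_iff₀ (by linarith)] at h1
  linarith

theorem extRightDeriv_eq {t : ℝ} (ht : t ∈ interior (effDom f)) :
    extRightDeriv f t = realRightDeriv f t := by
  have h2 : ∀ᶠ s in 𝓝[>] t, s ∈ effDom f :=
    nhdsWithin_le_nhds (mem_interior_iff_mem_nhds.1 ht)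
  have n1 : ¬ ∀ s, t < s → f s = ⊤ := by
    obtain ⟨s, h2, h3⟩ := (h2.and self_mem_nhdsWithin).exists
    exact fun h => h2 (h s h3)
  have n2 : ¬ ∃ s, t < s ∧ f s = ⊥ := fun ⟨s, _, hs⟩ => hf.ne_bot s hs
  rw [extRightDeriv, if_neg n1, if_neg n2]
  refine Tendsto.limUnder_eq ?_
  have h := (continuous_coe_real_ereal.tendsto _).comp (hf.tendsto_slope ht)
  refine h.congr' ?_
  filter_upwards [h2] with s hs
  rw [Function.comp_apply, slope_def_field, EReal.coe_div, EReal.coe_sub, hf.coe_toReal hs,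
    hf.coe_toReal (interior_subset ht)]

theorem extRightDeriv_eq_of_ne_top {t : ℝ} (ht : 0 < t) (h : extRightDeriv f t ≠ ⊤) :
    t ∈ interior (effDom f) := by
  have n1 : ¬ ∀ s, t < s → f s = ⊤ := fun n1 => h (by rw [extRightDeriv, if_pos n1])
  push Not at n1
  obtain ⟨s, hts, hs⟩ := n1
  exact hf.mem_interior_of_pos hs ht hts

theorem monotoneOn_extRightDeriv : MonotoneOn (extRightDeriv f) (Set.Ioi 0) := by
  intro s hs t ht hst
  by_cases h : extRightDeriv f t = ⊤
  · rw [h]; exact le_top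
  · have hti := hf.extRightDeriv_eq_of_ne_top ht h
    have hsi : s ∈ interior (effDom f) := by
      rcases hst.eq_or_lt with rfl | hst
      · exact hti
      · exact hf.mem_interior_of_pos (interior_subset hti) hs hst
    rw [hf.extRightDeriv_eq hti, hf.extRightDeriv_eq hsi]
    exact_mod_cast hf.realRightDeriv_mono hsi hti hst

/-! ### The right limit of the right derivative at `l` -/

variable {l : ℝ} (hl : 0 ≤ l)
include hl

/-- Monotonicity supplies the limit; without one, `Function.rightLim` would default to the value at
`l`. -/
theorem tendsto_extRightDeriv :
    Tendsto (extRightDeriv f) (𝓝[>] l) (𝓝 (Function.rightLim (extRightDeriv f) l)) :=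
  tendsto_rightLim_of_tendsto ⟨_, MonotoneOn.tendsto_nhdsGT
    (hf.monotoneOn_extRightDeriv.mono (Set.Ioi_subset_Ioi hl)) (OrderBot.bddBelow _)⟩

theorem rightLim_le_extRightDeriv {t : ℝ} (ht : l < t) :
    Function.rightLim (extRightDeriv f) l ≤ extRightDeriv f t := by
  refine le_of_tendsto (hf.tendsto_extRightDeriv hl) ?_
  filter_upwards [Ioo_mem_nhdsGT ht] with s hs
  exact hf.monotoneOn_extRightDeriv (hl.trans_lt hs.1) (hl.trans_lt ht) hs.2.le

/-- On a right neighbourhood of `l` where `f` is affine, its right derivative is the slope. -/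
theorem rightLim_eq_of_isAffineOn {t : ℝ} (hlt : l < t) (h : IsAffineOn f (Set.Ioc l t)) :
    ∃ a : ℝ, Function.rightLim (extRightDeriv f) l = a ∧
      ∀ s ∈ Set.Ioo l t, extRightDeriv f s = a := by
  obtain ⟨a, b, hab⟩ := h
  have ht : t ∈ effDom f := by
    rw [effDom, Set.mem_ofPred_eq, hab t ⟨hlt, le_rfl⟩]; exact EReal.coe_ne_top _
  have key : ∀ s ∈ Set.Ioo l t, extRightDeriv f s = a := by
    intro s hs
    have hsi := hf.mem_interior_of_pos ht (hl.trans_lt hs.1) hs.2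
    rw [hf.extRightDeriv_eq hsi]
    congr 1
    refine tendsto_nhds_unique (hf.tendsto_slope hsi) (tendsto_const_nhds.congr' ?_)
    filter_upwards [Ioo_mem_nhdsGT hs.2] with z hz
    have hzs : z - s ≠ 0 := (sub_pos.2 hz.1).ne'
    rw [slope_def_field, hab z ⟨hs.1.trans hz.1, hz.2.le⟩, hab s ⟨hs.1, hs.2.le⟩,
      EReal.toReal_coe, EReal.toReal_coe]
    field_simp
    ring
  refine ⟨a, tendsto_nhds_unique (hf.tendsto_extRightDeriv hl) (tendsto_const_nhds.congr' ?_), key⟩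
  filter_upwards [Ioo_mem_nhdsGT hlt] with s hs using (key s hs).symm

variable {r : ℝ} (hr : r ∈ effDom f) (hlr : l < r)
include hr hlr

theorem eventually_mem_interior : ∀ᶠ t in 𝓝[>] l, t ∈ interior (effDom f) := by
  filter_upwards [Ioo_mem_nhdsGT hlr] with t ht
  exact hf.mem_interior_of_pos hr (hl.trans_lt ht.1) ht.2

theorem eventually_coe_eq : ∀ᶠ t in 𝓝[>] l, (((f t).toReal : ℝ) : EReal) = f t := by
  filter_upwards [hf.eventually_mem_interior hl hr hlr] with t ht
  exact hf.coe_toReal (interior_subset ht)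

theorem tendsto_coe_realRightDeriv :
    Tendsto (fun t => ((realRightDeriv f t : ℝ) : EReal)) (𝓝[>] l)
      (𝓝 (Function.rightLim (extRightDeriv f) l)) := by
  refine (hf.tendsto_extRightDeriv hl).congr' ?_
  filter_upwards [hf.eventually_mem_interior hl hr hlr] with t ht
  exact hf.extRightDeriv_eq ht

/-! ### Finite limiting slope -/

section RealSlope

variable {d : ℝ} (hd : Function.rightLim (extRightDeriv f) l = d)
include hd

theorem tendsto_realRightDeriv : Tendsto (realRightDeriv f) (𝓝[>] l) (𝓝 d) := by
  have h := hf.tendsto_coe_realRightDeriv hl hr hlr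
  rw [hd] at h
  exact EReal.tendsto_coe.1 h

omit hr hlr in
theorem le_realRightDeriv {t : ℝ} (ht : t ∈ interior (effDom f)) (hlt : l < t) :
    d ≤ realRightDeriv f t := by
  have h := hf.rightLim_le_extRightDeriv hl hlt
  rw [hd, hf.extRightDeriv_eq ht] at h
  exact_mod_cast h

/-- The tilted function `f t - t d` tends to its infimum from the right of `l`. -/
theorem exists_tendsto_tilted : ∃ V : ℝ,
    Tendsto (fun t => (f t).toReal - t * d) (𝓝[>] l) (𝓝 V) ∧
      ∀ t ∈ effDom f, V ≤ (f t).toReal - t * d := by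
  obtain ⟨m, hlm, hmr⟩ := exists_between hlr
  have hint : ∀ t ∈ Set.Ioo l r, t ∈ interior (effDom f) := fun t ht =>
    hf.mem_interior_of_pos hr (hl.trans_lt ht.1) ht.2
  have hmono : MonotoneOn (fun t => (f t).toReal - t * d) (Set.Ioo l r) := by
    intro s hs t ht hst
    have h1 := hf.support_line (hint s hs) (interior_subset (hint t ht))
    have h2 := hf.le_realRightDeriv hl hd (hint s hs) hs.1
    have := mul_le_mul_of_nonneg_right h2 (sub_nonneg.2 hst)
    dsimp only
    linarith
  have hbdd : BddBelow ((fun t => (f t).toReal - t * d) '' Set.Ioo l r) := by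
    have hm := hint m ⟨hlm, hmr⟩
    refine ⟨(f m).toReal - m * d - (realRightDeriv f m - d) * (r + m), ?_⟩
    rintro _ ⟨t, ht, rfl⟩
    have h1 := hf.support_line hm (interior_subset (hint t ht))
    have h2 := hf.le_realRightDeriv hl hd hm hlm
    have ht0 : 0 < t := hl.trans_lt ht.1
    have : 0 ≤ (realRightDeriv f m - d) * (t + r) :=
      mul_nonneg (by linarith) (by linarith)
    dsimp only
    linarith
  have hlim := hmono.tendsto_nhdsWithin_Ioo_right (Set.nonempty_Ioo.2 hlr) hbdd
  refine ⟨_, hlim, fun t ht => ?_⟩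
  -- The support line of the tilted function at `s` has slope tending to `0` as `s ↓ l`, so `V`
  -- bounds it below everywhere, including to the left of `l`.
  have h1 : Tendsto (fun s => ((f s).toReal - s * d) + (realRightDeriv f s - d) * (t - s)) (𝓝[>] l)
      (𝓝 (sInf ((fun t => (f t).toReal - t * d) '' Set.Ioo l r) + (d - d) * (t - l))) :=
    hlim.add (((hf.tendsto_realRightDeriv hl hr hlr hd).sub_const d).mul
      ((tendsto_const_nhds (x := t)).sub (tendsto_id.mono_left nhdsWithin_le_nhds)))
  rw [sub_self, zero_mul, add_zero] at h1
  refine le_of_tendsto h1 ?_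
  filter_upwards [hf.eventually_mem_interior hl hr hlr] with s hs
  have := hf.support_line hs ht
  linarith

omit hr hlr in
/-- To the right of the affine part of `f` there are points whose right derivative is close
to `d`. -/
theorem exists_affineSup_lt (hacc : AccPt (d : EReal) (𝓟 (extRightDeriv f '' Set.Ioi l))) {ε : ℝ}
    (hε : 0 < ε) : ∃ t : ℝ, affineSup f l < t ∧ t ∈ interior (effDom f) ∧
      realRightDeriv f t < d + ε := by
  have step : ∀ e : EReal, (d : EReal) < e →
      ∃ t > l, (d : EReal) < extRightDeriv f t ∧ extRightDeriv f t < e := by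
    intro e he
    rw [accPt_iff_nhds] at hacc
    obtain ⟨_, ⟨h1, t, ht, rfl⟩, h2⟩ := hacc _ (Iio_mem_nhds he)
    refine ⟨t, ht, lt_of_le_of_ne ?_ h2.symm, h1⟩
    rw [← hd]
    exact hf.rightLim_le_extRightDeriv hl ht
  -- Two points with right derivatives `d < f'(s) < f'(t) < d + ε`. On an affine piece starting at
  -- `l` the derivative is `d`, so `s` lies beyond its interior, and `t > s` makes the inequality
  -- strict.
  obtain ⟨t, ht, hdt, hte⟩ := step ((d + ε : ℝ) : EReal) (by exact_mod_cast lt_add_of_pos_right d hε)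
  obtain ⟨s, hs, hds, hst⟩ := step _ hdt
  have hti := hf.extRightDeriv_eq_of_ne_top (hl.trans_lt ht) (hte.trans (EReal.coe_lt_top _)).ne
  refine ⟨t, ?_, hti, by rw [hf.extRightDeriv_eq hti] at hte; exact_mod_cast hte⟩
  have hlt : s < t := by
    by_contra h
    exact hst.not_ge (hf.monotoneOn_extRightDeriv (hl.trans_lt ht) (hl.trans_lt hs) (not_lt.1 h))
  refine lt_of_le_of_lt (b := (s : EReal)) ?_ (by exact_mod_cast hlt)
  refine max_le (by exact_mod_cast (le_of_lt hs)) (iSup₂_le fun u hu => ?_)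
  by_contra h
  have hsu : s < u := by exact_mod_cast not_le.1 h
  obtain ⟨a, ha, ha'⟩ := hf.rightLim_eq_of_isAffineOn hl hu.1 hu.2
  rw [ha' s ⟨hs, hsu⟩, ← ha, hd] at hds
  exact lt_irrefl _ hds

omit hr hlr in
-- If every chord ending at `t` had slope at most `d`, support lines of slope at least `d` would
-- force equality, making `f` affine on `]l, t]`.
theorem exists_lt_slope {t : ℝ} (hlt : affineSup f l < t) (ht : t ∈ effDom f) :
    ∃ s ∈ Set.Ioo l t, s ∈ effDom f ∧ (f s).toReal + (t - s) * d < (f t).toReal := by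
  have hlt' : l < t := by exact_mod_cast (le_max_left _ _).trans_lt hlt
  have hint : ∀ s ∈ Set.Ioo l t, s ∈ interior (effDom f) := fun s hs =>
    hf.mem_interior_of_pos ht (hl.trans_lt hs.1) hs.2
  by_contra! hcon
  refine hlt.not_ge (le_max_of_le_right (le_iSup₂_of_le t ⟨hlt', d, (f t).toReal - d * t, ?_⟩ le_rfl))
  intro s hs
  rcases hs.2.eq_or_lt with rfl | hst
  · rw [← hf.coe_toReal ht]; congr 1; rw [EReal.toReal_coe]; ring
  · have hsi := hint s ⟨hs.1, hst⟩
    have h1 := hcon s ⟨hs.1, hst⟩ (interior_subset hsi)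
    have h2 := hf.support_line hsi ht
    have h3 := mul_le_mul_of_nonneg_right (hf.le_realRightDeriv hl hd hsi hs.1)
      (sub_nonneg.2 hst.le)
    rw [← hf.coe_toReal (interior_subset hsi)]
    congr 1
    linarith

end RealSlope

/-! ### Limiting slope `-∞` -/

section InfiniteSlope

variable (hD : Function.rightLim (extRightDeriv f) l = ⊥)
include hD

theorem tendsto_realRightDeriv_atBot : Tendsto (realRightDeriv f) (𝓝[>] l) atBot := by
  have h := hf.tendsto_coe_realRightDeriv hl hr hlr
  rw [hD] at h
  exact EReal.tendsto_coe_nhds_bot_iff.1 h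

omit hr hlr in
theorem affineSup_eq : affineSup f l = l := by
  refine max_eq_left (iSup₂_le fun u hu => ?_)
  obtain ⟨a, ha, -⟩ := hf.rightLim_eq_of_isAffineOn hl hu.1 hu.2
  rw [hD] at ha
  exact absurd ha.symm (EReal.coe_ne_bot _)

/-- Near `l` the values of `f` are bounded below, while support lines there have slopes tending to
`-∞`; at a point `t < l` they exceed every bound. -/
theorem eq_top_of_lt {t : ℝ} (ht : t < l) : f t = ⊤ := by
  by_contra h
  obtain ⟨m, hlm, hmr⟩ := exists_between hlr
  have hm := hf.mem_interior_of_pos hr (hl.trans_lt hlm) hmr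
  have hlim : Tendsto (fun s => -(realRightDeriv f s) * (s - t)) (𝓝[>] l) atTop := by
    refine Tendsto.atTop_mul_pos (sub_pos.2 ht)
      (tendsto_neg_atBot_atTop.comp (hf.tendsto_realRightDeriv_atBot hl hr hlr hD)) ?_
    exact (tendsto_id.mono_left nhdsWithin_le_nhds).sub_const t
  obtain ⟨s, ⟨h1, h2⟩, h3⟩ := ((hlim.eventually (eventually_gt_atTop
    ((f t).toReal - ((f m).toReal - |realRightDeriv f m| * (m - l)))) ).and
    (hf.eventually_mem_interior hl hr hlr) |>.and (Ioo_mem_nhdsGT hlm)).exists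
  have h4 := hf.support_line h2 (t := t) h
  have h5 := hf.support_line hm (interior_subset h2)
  have h6 : realRightDeriv f m * (m - s) ≤ |realRightDeriv f m| * (m - l) :=
    mul_le_mul (le_abs_self _) (by linarith [h3.1]) (by linarith [h3.2]) (abs_nonneg _)
  linarith

theorem eq_zero_of_rightLim_eq_bot : l = 0 := by
  rcases hl.eq_or_lt with h | h
  · exact h.symm
  · have := hf.eq_top_of_lt hl hr hlr hD h
    rw [hf.zero] at this
    exact absurd this EReal.zero_ne_top

/-- Where the slope is negative `f` is antitone, so the right limit exists; continuity identifies it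
with `f 0 = 0`. -/
theorem tendsto_toReal_of_rightLim (h0 : f l = Function.rightLim f l) :
    Tendsto (fun t => (f t).toReal) (𝓝[>] l) (𝓝 0) := by
  have hl0 := hf.eq_zero_of_rightLim_eq_bot hl hr hlr hD
  obtain ⟨m, hm, hneg⟩ := (mem_nhdsGT_iff_exists_Ioo_subset' hlr).1 (inter_mem
    ((hf.tendsto_realRightDeriv_atBot hl hr hlr hD).eventually (eventually_lt_atBot 0))
    (hf.eventually_mem_interior hl hr hlr))
  have hanti : AntitoneOn f (Set.Ioo l m) := by
    intro s hs t ht hst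
    have h1 := hf.support_line (hneg ht).2 (interior_subset (hneg hs).2)
    have h2 : 0 ≤ realRightDeriv f t * (s - t) :=
      mul_nonneg_of_nonpos_of_nonpos (hneg ht).1.le (by linarith)
    rw [← hf.coe_toReal (interior_subset (hneg hs).2), ← hf.coe_toReal (interior_subset (hneg ht).2)]
    exact_mod_cast (by linarith : (f t).toReal ≤ (f s).toReal)
  have hlim := hanti.tendsto_nhdsWithin_Ioo_right (Set.nonempty_Ioo.2 hm) (OrderTop.bddAbove _)
  have hlim2 := tendsto_rightLim_of_tendsto ⟨_, hlim⟩
  rw [← h0, hl0, hf.zero, ← hl0] at hlim2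
  rw [← EReal.tendsto_coe]
  refine hlim2.congr' ?_
  filter_upwards [hf.eventually_coe_eq hl hr hlr] with t ht using ht.symm

end InfiniteSlope

end IsProperConvex

/-- If `f = ⊤` to the right of `l`, the right derivative is constantly `⊤` there and has no
accumulation point. If `f` takes the value `⊥` there, then `f` and its right derivative both have
right limit `⊥` at `l`, against `h_cont`. -/
theorem IsProperConvex.of_rightLim {f : ℝ → EReal} (hf : EConvex f) (h0 : f 0 = 0) {l : ℝ}
    (hl : 0 ≤ l)
    (h_acc : Function.rightLim (extRightDeriv f) l ≠ ⊥ →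
      AccPt (Function.rightLim (extRightDeriv f) l) (𝓟 (extRightDeriv f '' Set.Ioi l)))
    (h_cont : Function.rightLim (extRightDeriv f) l = ⊥ →
      f l = Function.rightLim f l ∧ f l ≠ ⊥) :
    IsProperConvex f ∧ ∃ r ∈ effDom f, l < r := by
  by_cases htop : ∀ s, l < s → f s = ⊤
  · exfalso
    have hE : ∀ t ∈ Set.Ioi l, extRightDeriv f t = ⊤ := fun t ht => by
      rw [extRightDeriv, if_pos fun s hs => htop s (lt_trans ht hs)]
    have hD : Function.rightLim (extRightDeriv f) l = ⊤ :=
      rightLim_eq_of_tendsto (tendsto_const_nhds.congr'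
        (eventually_nhdsWithin_of_forall fun t ht => (hE t ht).symm))
    rw [hD] at h_acc
    have h := h_acc top_ne_bot
    rw [accPt_iff_nhds] at h
    obtain ⟨_, ⟨-, t, ht, rfl⟩, hne⟩ := h _ univ_mem
    exact hne (hE t ht)
  push Not at htop
  obtain ⟨r, hlr, hr⟩ := htop
  by_cases hbot : ∃ s, l < s ∧ f s = ⊥
  · exfalso
    obtain ⟨s, hls, hs⟩ := hbot
    have hfz : ∀ z ∈ Set.Ioo l s, f z = ⊥ := fun z hz =>
      hf.eq_bot_of_gt hz.2 (hl.trans_lt hz.1) hs (by simp [h0])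
    have hD : Function.rightLim (extRightDeriv f) l = ⊥ := by
      refine rightLim_eq_of_tendsto (tendsto_const_nhds.congr' ?_)
      filter_upwards [Ioo_mem_nhdsGT hls] with z hz
      rw [extRightDeriv, if_neg fun h => by simpa [hs] using h s hz.2, if_pos ⟨s, hz.2, hs⟩]
    have hLp : Function.rightLim f l = ⊥ := by
      refine rightLim_eq_of_tendsto (tendsto_const_nhds.congr' ?_)
      filter_upwards [Ioo_mem_nhdsGT hls] with z hz using (hfz z hz).symm
    obtain ⟨h1, h2⟩ := h_cont hD
    exact h2 (h1.trans hLp)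
  push Not at hbot
  refine ⟨⟨hf, fun u hu => ?_, h0⟩, r, hr, hlr⟩
  obtain ⟨m, hlm, hmr⟩ := exists_between hlr
  exact hbot m hlm (hf.eq_bot_of_lt ((not_lt.1 fun h => hbot u h hu).trans_lt hlm) hmr hu hr)

/-! ### The Legendre-Fenchel transform -/

namespace IsProperConvex

variable {f : ℝ → EReal} (hf : IsProperConvex f) {l : ℝ} (hl : 0 ≤ l) {r : ℝ} (hr : r ∈ effDom f)
  (hlr : l < r)
include hf hl hr hlr

section RealSlope

variable {d V : ℝ} (hV : Tendsto (fun t => (f t).toReal - t * d) (𝓝[>] l) (𝓝 V))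
  (hV' : ∀ t ∈ effDom f, V ≤ (f t).toReal - t * d)
include hV

theorem rightLim_eq : Function.rightLim f l = ((V + l * d : ℝ) : EReal) := by
  refine rightLim_eq_of_tendsto ?_
  have h : Tendsto (fun t => (f t).toReal - t * d + t * d) (𝓝[>] l) (𝓝 (V + l * d)) :=
    hV.add ((tendsto_id.mono_left nhdsWithin_le_nhds).mul_const d)
  refine ((continuous_coe_real_ereal.tendsto _).comp h).congr' ?_
  filter_upwards [hf.eventually_coe_eq hl hr hlr] with t ht
  rw [Function.comp_apply, sub_add_cancel, ht]

include hV'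

theorem neg_legendreFenchel_eq : -legendreFenchel f d = V := by
  rw [neg_eq_iff_eq_neg]
  refine le_antisymm (iSup_le fun t => ?_) ?_
  · by_cases ht : f t = ⊤
    · rw [ht, EReal.sub_top]; exact bot_le
    · rw [← hf.coe_toReal ht]
      have := hV' t ht
      exact_mod_cast (by linarith : t * d - (f t).toReal ≤ -V)
  · have h : Tendsto (fun t => ((-((f t).toReal - t * d) : ℝ) : EReal)) (𝓝[>] l)
        (𝓝 ((-V : ℝ) : EReal)) := (continuous_coe_real_ereal.tendsto _).comp hV.neg
    refine le_of_tendsto (by simpa using h) ?_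
    filter_upwards [hf.eventually_coe_eq hl hr hlr] with t ht
    refine le_trans ?_ (le_iSup _ t)
    rw [← ht, EReal.toReal_coe]

/-- Restricting to `t > 0` loses nothing, since `V` is approached as `t ↓ l ≥ 0`. -/
theorem iInf_tilted_eq : ⨅ t ∈ Set.Ioi (0 : ℝ), (f t - (t : EReal) * d) = V := by
  refine le_antisymm ?_ (le_iInf₂ fun t _ => ?_)
  · have h : Tendsto (fun t => (((f t).toReal - t * d : ℝ) : EReal)) (𝓝[>] l)
        (𝓝 (V : EReal)) := (continuous_coe_real_ereal.tendsto _).comp hV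
    refine ge_of_tendsto h ?_
    filter_upwards [hf.eventually_coe_eq hl hr hlr, self_mem_nhdsWithin] with t ht hlt
    refine (iInf₂_le t (hl.trans_lt hlt)).trans ?_
    rw [← ht, EReal.toReal_coe]
    exact_mod_cast le_rfl
  · by_cases ht : f t = ⊤
    · rw [ht, ← EReal.coe_mul, EReal.top_sub_coe]; exact le_top
    · rw [← hf.coe_toReal ht]
      exact_mod_cast hV' t ht

end RealSlope

theorem tendsto_legendreFenchel (hD : Function.rightLim (extRightDeriv f) l = ⊥)
    (h0 : f l = Function.rightLim f l) {ι : Type*} {F : Filter ι} {x : ι → EReal}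
    (hx : Tendsto x F (𝓝 ⊥)) : Tendsto (fun α => legendreFenchel f (x α)) F (𝓝 0) := by
  have hl0 := hf.eq_zero_of_rightLim_eq_bot hl hr hlr hD
  refine tendsto_order.2 ⟨fun v hv => Eventually.of_forall fun α => ?_, fun v hv => ?_⟩
  · refine hv.trans_le (le_trans ?_ (le_iSup _ 0))
    simp [hf.zero]
  · obtain ⟨ε, hε, hεv⟩ := EReal.lt_iff_exists_real_btwn.1 hv
    have hε : 0 < ε := by exact_mod_cast hε
    -- With `f'(s) < 0` and `f s > -ε`, the support line at `s` gives `t x - f t ≤ ε` for all `t >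
    -- 0` once `x` is below `f'(s)`. The orders `t < 0` contribute `⊥`.
    obtain ⟨s, ⟨⟨h1, h2⟩, h3⟩, h4⟩ := ((((hf.tendsto_realRightDeriv_atBot hl hr hlr hD).eventually
      (eventually_lt_atBot 0)).and ((hf.tendsto_toReal_of_rightLim hl hr hlr hD h0).eventually
      (lt_mem_nhds (neg_neg_of_pos hε)))).and (hf.eventually_mem_interior hl hr hlr) |>.and
      self_mem_nhdsWithin).exists
    have hs : 0 < s := hl.trans_lt h4
    filter_upwards [hx.eventually (gt_mem_nhds (EReal.bot_lt_coe (realRightDeriv f s)))] with α hα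
    refine lt_of_le_of_lt (iSup_le fun t => ?_) hεv
    rcases lt_trichotomy t 0 with ht | rfl | ht
    · rw [hf.eq_top_of_lt hl hr hlr hD (hl0 ▸ ht), EReal.sub_top]; exact bot_le
    · simpa [hf.zero] using hε.le
    · by_cases htop : f t = ⊤
      · rw [htop, EReal.sub_top]; exact bot_le
      · refine (EReal.sub_le_sub (mul_le_mul_of_nonneg_left hα.le
          (by exact_mod_cast ht.le)) le_rfl).trans ?_
        rw [← hf.coe_toReal htop]
        have h5 := hf.support_line h3 htop
        have h6 := mul_pos_of_neg_of_neg h1 (neg_neg_of_pos hs)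
        exact_mod_cast (by linarith : t * realRightDeriv f s - (f t).toReal ≤ ε)

end IsProperConvex

/-! ### Large deviations -/

section Net

variable {ι : Type*} [Preorder ι] [IsDirectedOrder ι] [Nonempty ι] {μ : ι → Measure ℝ} {c : ι → ℝ}

/-- The lower bound at `v` holds along each subnet on which the generating function of order `t`
is asymptotically at least its upper limit. -/
def LowerBoundAt (μ : ι → Measure ℝ) (c : ι → ℝ) (x y : ι → EReal) (v t : ℝ) : Prop :=
  ∃ P : ℝ, genLogMgf μ c t = P ∧ ∃ δ > 0, ∀ᶠ α in atTop,
    ((P - δ : ℝ) : EReal) ≤ scaledLogMgf (μ α) (c α) t →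
      (v : EReal) ≤ scaledLogIoo (μ α) (c α) (x α) (y α)

omit [IsDirectedOrder ι] [Nonempty ι] in
theorem eConvex_genLogMgf (hc : ∀ α, 0 < c α) : EConvex (genLogMgf μ c) :=
  fun _ _ _ _ _ _ hp hq hpq hA hB => genLogMgf_combo_le hc hp hq hpq hA hB

/-- The moment of order `t` is frequently within `δ` of its upper limit, which bounds the upper
limit of the probabilities; when it converges this holds eventually, and one `t i < t₀` suffices. -/
theorem limsup_eq_and_tendsto (hc_pos : ∀ α, 0 < c α) {x y : ι → EReal} {V : ℝ} {e : EReal}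
    (upper : ∀ v : ℝ, V < v → ∀ᶠ α in atTop, scaledLogIcc (μ α) (c α) (x α) (y α) ≤ v)
    (lower : ∀ v : ℝ, v < V → ∃ t₀ : ℝ, e < t₀ ∧
      ∀ t : ℝ, e < t → t < t₀ → LowerBoundAt μ c x y v t) :
    limsup (fun α => scaledLogIcc (μ α) (c α) (x α) (y α)) atTop = V ∧
    limsup (fun α => scaledLogIoo (μ α) (c α) (x α) (y α)) atTop = V ∧
    (∀ t : ℕ → ℝ, (∀ i, e < (t i : EReal)) → Tendsto (fun i => (t i : EReal)) atTop (𝓝 e) →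
      (∀ i, ∃ a : EReal, Tendsto (fun α => scaledLogMgf (μ α) (c α) (t i)) atTop (𝓝 a)) →
      Tendsto (fun α => scaledLogIcc (μ α) (c α) (x α) (y α)) atTop (𝓝 V) ∧
      Tendsto (fun α => scaledLogIoo (μ α) (c α) (x α) (y α)) atTop (𝓝 V)) := by
  have hle : ∀ α, scaledLogIoo (μ α) (c α) (x α) (y α) ≤ scaledLogIcc (μ α) (c α) (x α) (y α) :=
    fun α => scaledLogIoo_le_scaledLogIcc _ (hc_pos α) _ _
  have hIcc : limsup (fun α => scaledLogIcc (μ α) (c α) (x α) (y α)) atTop ≤ V := by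
    by_contra h
    obtain ⟨v, h1, h2⟩ := EReal.lt_iff_exists_real_btwn.1 (not_le.1 h)
    exact h2.not_ge (limsup_le_of_le (by isBoundedDefault) (upper v (by exact_mod_cast h1)))
  have hIoo : (V : EReal) ≤ limsup (fun α => scaledLogIoo (μ α) (c α) (x α) (y α)) atTop := by
    by_contra h
    obtain ⟨v, h1, h2⟩ := EReal.lt_iff_exists_real_btwn.1 (not_le.1 h)
    obtain ⟨t₀, ht₀, hlow⟩ := lower v (by exact_mod_cast h2)
    obtain ⟨t, het, htt⟩ := EReal.lt_iff_exists_real_btwn.1 ht₀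
    obtain ⟨P, hP, δ, hδ, hev⟩ := hlow t het (by exact_mod_cast htt)
    have hfreq : ∃ᶠ α in atTop, ((P - δ : ℝ) : EReal) < scaledLogMgf (μ α) (c α) t := by
      refine frequently_lt_of_lt_limsup (by isBoundedDefault) ?_
      change _ < genLogMgf μ c t
      rw [hP]
      exact_mod_cast sub_lt_self P hδ
    refine h1.not_ge (le_limsup_of_frequently_le ?_ (by isBoundedDefault))
    exact (hfreq.and_eventually hev).mono fun α h => h.2 h.1.le
  have hlim := limsup_le_limsup (Eventually.of_forall hle) (f := atTop)
  refine ⟨le_antisymm hIcc (hIoo.trans hlim), le_antisymm (hlim.trans hIcc) hIoo, ?_⟩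
  intro t hte ht hex
  have hup : ∀ w : EReal, (V : EReal) < w →
      ∀ᶠ α in atTop, scaledLogIcc (μ α) (c α) (x α) (y α) < w := by
    intro w hw
    obtain ⟨v, h1, h2⟩ := EReal.lt_iff_exists_real_btwn.1 hw
    exact (upper v (by exact_mod_cast h1)).mono fun α h => h.trans_lt h2
  have hlo : ∀ w : EReal, w < (V : EReal) →
      ∀ᶠ α in atTop, w < scaledLogIoo (μ α) (c α) (x α) (y α) := by
    intro w hw
    obtain ⟨v, h1, h2⟩ := EReal.lt_iff_exists_real_btwn.1 hw
    obtain ⟨t₀, ht₀, hlow⟩ := lower v (by exact_mod_cast h2)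
    obtain ⟨i, hi⟩ := (ht.eventually (gt_mem_nhds ht₀)).exists
    obtain ⟨P, hP, δ, hδ, hev⟩ := hlow (t i) (hte i) (by exact_mod_cast hi)
    obtain ⟨a, ha⟩ := hex i
    have haP : a = P := by rw [← hP]; exact ha.limsup_eq.symm
    rw [haP] at ha
    filter_upwards [hev, ha.eventually (lt_mem_nhds
      (show ((P - δ : ℝ) : EReal) < P by exact_mod_cast sub_lt_self P hδ))] with α k1 k2
    exact h1.trans_le (k1 k2.le)
  exact ⟨tendsto_order.2 ⟨fun w hw => (hlo w hw).mono fun α h => h.trans_le (hle α), hup⟩,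
    tendsto_order.2 ⟨hlo, fun w hw => (hup w hw).mono fun α h => (hle α).trans_lt h⟩⟩

omit [IsDirectedOrder ι] [Nonempty ι] in
theorem lowerBoundAt_of_real_slope (hμ : ∀ α, IsProbabilityMeasure (μ α)) (hc_pos : ∀ α, 0 < c α)
    (hc : Tendsto c atTop (𝓝 0)) (hf : IsProperConvex (genLogMgf μ c)) {l : ℝ} (hl : 0 ≤ l)
    {d V : ℝ}
    (hd : Function.rightLim (extRightDeriv (genLogMgf μ c)) l = d)
    (hacc : AccPt (d : EReal) (𝓟 (extRightDeriv (genLogMgf μ c) '' Set.Ioi l)))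
    (hV' : ∀ t ∈ effDom (genLogMgf μ c), V ≤ (genLogMgf μ c t).toReal - t * d)
    {x y : ι → EReal} (hx : Tendsto x atTop (𝓝 d)) (hy : (d : EReal) < liminf y atTop)
    {v : ℝ} (hv : v < V) :
    ∃ t₀ : ℝ, affineSup (genLogMgf μ c) l < t₀ ∧
      ∀ t : ℝ, affineSup (genLogMgf μ c) l < t → t < t₀ → LowerBoundAt μ c x y v t := by
  obtain ⟨b₀, hdb, hby⟩ := EReal.lt_iff_exists_real_btwn.1 hy
  have hdb : d < b₀ := by exact_mod_cast hdb
  obtain ⟨T, hT, -, -⟩ := hf.exists_affineSup_lt hl hd hacc one_pos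
  have hlT : l < T := by exact_mod_cast (le_max_left _ _).trans_lt hT
  have hT0 : 0 < T := hl.trans_lt hlT
  -- `T` is fixed before `ε` so that `t ε < T ε ≤ V - v` for every `t < T`; hence `L t - t (d + ε) >
  -- v`.
  obtain ⟨ε, hε, hε1, hε2⟩ : ∃ ε > 0, ε ≤ b₀ - d ∧ T * ε ≤ V - v := by
    refine ⟨min (b₀ - d) ((V - v) / T), lt_min (by linarith) (div_pos (by linarith) hT0),
      min_le_left _ _, ?_⟩
    rw [← le_div_iff₀' hT0]
    exact min_le_right _ _
  obtain ⟨u, hu, hui, hud⟩ := hf.exists_affineSup_lt hl hd hacc hε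
  refine ⟨min T u, ?_, fun t hlt htu => ?_⟩
  · rcases min_choice T u with h | h <;> rwa [h]
  have hltr : l < t := by exact_mod_cast (le_max_left _ _).trans_lt hlt
  have htT := htu.trans_le (min_le_left _ _)
  have htu := htu.trans_le (min_le_right _ _)
  have hti := hf.mem_interior_of_pos (interior_subset hui) (hl.trans_lt hltr) htu
  have htd := interior_subset hti
  obtain ⟨p, hp, hpd, hslope⟩ := hf.exists_lt_slope hl hd hlt htd
  obtain ⟨s, hts, hsd, hs⟩ := hf.exists_slope_lt hti
    ((hf.realRightDeriv_mono hti hui htu.le).trans_lt hud)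
  have htp : 0 < t - p := sub_pos.2 hp.2
  obtain ⟨a, hda, ha⟩ : ∃ a, d < a ∧
      a < ((genLogMgf μ c t).toReal - (genLogMgf μ c p).toReal) / (t - p) :=
    exists_between (by rw [lt_div_iff₀ htp]; linarith)
  rw [lt_div_iff₀ htp] at ha
  refine ⟨_, (hf.coe_toReal htd).symm, eventually_le_scaledLogIoo hμ hc_pos hc hx hp.2 hts
    (hl.trans hltr.le) (hf.coe_toReal hpd).symm (hf.coe_toReal hsd).symm (a := a) (b := d + ε)
    (by exact_mod_cast hda) (lt_of_le_of_lt (by exact_mod_cast (by linarith)) hby) (by linarith) hs ?_⟩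
  have h1 := hV' t htd
  have h2 := mul_lt_mul_of_pos_right htT hε
  linarith

omit [IsDirectedOrder ι] [Nonempty ι] in
theorem lowerBoundAt_of_slope_bot (hμ : ∀ α, IsProbabilityMeasure (μ α)) (hc_pos : ∀ α, 0 < c α)
    (hc : Tendsto c atTop (𝓝 0)) (hf : IsProperConvex (genLogMgf μ c)) {l : ℝ} (hl : 0 ≤ l) {r : ℝ}
    (hr : r ∈ effDom (genLogMgf μ c)) (hlr : l < r)
    (hD : Function.rightLim (extRightDeriv (genLogMgf μ c)) l = ⊥)
    (h0 : genLogMgf μ c l = Function.rightLim (genLogMgf μ c) l)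
    {x y : ι → EReal} (hx : Tendsto x atTop (𝓝 ⊥)) (hy : ⊥ < liminf y atTop)
    {v : ℝ} (hv : v < 0) :
    ∃ t₀ : ℝ, affineSup (genLogMgf μ c) l < t₀ ∧
      ∀ t : ℝ, affineSup (genLogMgf μ c) l < t → t < t₀ → LowerBoundAt μ c x y v t := by
  obtain ⟨b, -, hb⟩ := EReal.lt_iff_exists_real_btwn.1 (lt_min hy (EReal.bot_lt_coe 0))
  have hby := hb.trans_le (min_le_left _ _)
  have hb0 : b < 0 := by exact_mod_cast hb.trans_le (min_le_right _ _)
  obtain ⟨m, hm, hmem⟩ := (mem_nhdsGT_iff_exists_Ioo_subset' hlr).1 (inter_mem (inter_mem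
    ((hf.tendsto_realRightDeriv_atBot hl hr hlr hD).eventually (eventually_lt_atBot b))
    (hf.eventually_mem_interior hl hr hlr))
    ((hf.tendsto_toReal_of_rightLim hl hr hlr hD h0).eventually (lt_mem_nhds hv)))
  rw [hf.affineSup_eq hl hD]
  refine ⟨m, by exact_mod_cast hm, fun t hlt htm => ?_⟩
  have hlt : l < t := by exact_mod_cast hlt
  have ht0 : 0 < t := hl.trans_lt hlt
  obtain ⟨⟨h1, hti⟩, h3⟩ := hmem ⟨hlt, htm⟩
  obtain ⟨s, hts, hsd, hs⟩ := hf.exists_slope_lt hti h1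
  have h3 : v < (genLogMgf μ c t).toReal := h3
  -- The left comparison order is `0`, where `L` vanishes. As `x` tends to `⊥`, any real `a` is
  -- admissible; this one makes `t a = L t - 1`.
  refine ⟨_, (hf.coe_toReal (interior_subset hti)).symm, eventually_le_scaledLogIoo hμ hc_pos hc hx
    ht0 hts ht0.le (A := 0) (by simpa using hf.zero) (hf.coe_toReal hsd).symm
    (a := ((genLogMgf μ c t).toReal - 1) / t) (b := b) (EReal.bot_lt_coe _) hby ?_ hs ?_⟩
  · rw [sub_zero, mul_div_cancel₀ _ ht0.ne']; linarith
  · have := mul_pos_of_neg_of_neg hb0 (neg_neg_of_pos ht0)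
    linarith

omit [IsDirectedOrder ι] [Nonempty ι] in
theorem eventually_scaledLogIcc_le_of_real_slope (hc_pos : ∀ α, 0 < c α)
    (hf : IsProperConvex (genLogMgf μ c)) {l : ℝ} (hl : 0 ≤ l) {r : ℝ}
    (hr : r ∈ effDom (genLogMgf μ c)) (hlr : l < r) {d V : ℝ}
    (hV : Tendsto (fun t => (genLogMgf μ c t).toReal - t * d) (𝓝[>] l) (𝓝 V))
    {x y : ι → EReal} (hx : Tendsto x atTop (𝓝 d)) {v : ℝ} (hv : V < v) :
    ∀ᶠ α in atTop, scaledLogIcc (μ α) (c α) (x α) (y α) ≤ v := by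
  obtain ⟨t, ⟨h1, h2⟩, h3⟩ := (((hV.eventually (gt_mem_nhds hv)).and
    (hf.eventually_coe_eq hl hr hlr)).and self_mem_nhdsWithin).exists
  have ht : 0 < t := hl.trans_lt h3
  -- Since `L t - t d < v`, there is room to lower `d` to some `a < d`, which `x` eventually
  -- exceeds.
  obtain ⟨a, ha, had⟩ : ∃ a, ((genLogMgf μ c t).toReal - v) / t < a ∧ a < d :=
    exists_between (by rw [div_lt_iff₀ ht]; linarith)
  rw [div_lt_iff₀ ht] at ha
  exact eventually_scaledLogIcc_le hc_pos ht.le h2.symm hx (by exact_mod_cast had) (by linarith)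

end Net

theorem theorem1p1 {ι : Type*} [Preorder ι] [IsDirectedOrder ι] [Nonempty ι]
    (μ : ι → Measure ℝ) (hμ : ∀ α, IsProbabilityMeasure (μ α))
    (c : ι → ℝ) (hc_pos : ∀ α, 0 < c α) (hc : Tendsto c atTop (𝓝 0))
    (l : ℝ) (hl : 0 ≤ l)
    -- `L` is the generalized log-moment generating function, `Lp = L(l⁺)`, `D = L'_r(l⁺)`
    (L : ℝ → EReal) (hL : L = genLogMgf μ c)
    (Lp : EReal) (hLp : Lp = Function.rightLim L l)
    (D : EReal) (hD : D = Function.rightLim (extRightDeriv L) l)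
    (h_acc : D ≠ ⊥ → AccPt D (𝓟 (extRightDeriv L '' Set.Ioi l)))
    (h_cont : D = ⊥ → L l = Lp ∧ L l ≠ ⊥)
    (x y : ι → EReal) (hx : Tendsto x atTop (𝓝 D)) (hy : D < liminf y atTop) :
    limsup (fun α => scaledLogIcc (μ α) (c α) (x α) (y α)) atTop = Lp - (l : EReal) * D ∧
    limsup (fun α => scaledLogIoo (μ α) (c α) (x α) (y α)) atTop = Lp - (l : EReal) * D ∧
    (D ≠ ⊥ →
      Lp - (l : EReal) * D = -legendreFenchel L D ∧
      -legendreFenchel L D = ⨅ t ∈ Set.Ioi (0 : ℝ), (L t - (t : EReal) * D)) ∧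
    (D = ⊥ →
      Lp - (l : EReal) * D = 0 ∧
      Tendsto (fun α => legendreFenchel L (x α)) atTop (𝓝 0)) ∧
    (∀ t : ℕ → ℝ, (∀ i, affineSup L l < (t i : EReal)) →
      Tendsto (fun i => (t i : EReal)) atTop (𝓝 (affineSup L l)) →
      (∀ i, ∃ a : EReal, Tendsto (fun α => scaledLogMgf (μ α) (c α) (t i)) atTop (𝓝 a)) →
      Tendsto (fun α => scaledLogIcc (μ α) (c α) (x α) (y α)) atTop (𝓝 (Lp - (l : EReal) * D)) ∧
      Tendsto (fun α => scaledLogIoo (μ α) (c α) (x α) (y α)) atTop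
        (𝓝 (Lp - (l : EReal) * D))) := by

  subst hL hLp hD
  obtain ⟨hf, r, hr, hlr⟩ := IsProperConvex.of_rightLim (eConvex_genLogMgf hc_pos)
    (genLogMgf_zero hμ) hl h_acc h_cont
  by_cases hD : Function.rightLim (extRightDeriv (genLogMgf μ c)) l = ⊥
  · have h0 := (h_cont hD).1
    have hl0 := hf.eq_zero_of_rightLim_eq_bot hl hr hlr hD
    have hval : Function.rightLim (genLogMgf μ c) l -
        (l : EReal) * Function.rightLim (extRightDeriv (genLogMgf μ c)) l = ((0 : ℝ) : EReal) := by
      rw [← h0, hl0, hf.zero]; simp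
    rw [hD] at hx hy
    obtain ⟨h1, h2, h3⟩ := limsup_eq_and_tendsto (V := 0) hc_pos
      (e := affineSup (genLogMgf μ c) l) (x := x) (y := y)
      (fun v hv => Eventually.of_forall fun α => by
        have := hμ α
        exact (scaledLogIcc_nonpos _ (hc_pos α) _ _).trans (by exact_mod_cast hv.le))
      (fun v hv => lowerBoundAt_of_slope_bot hμ hc_pos hc hf hl hr hlr hD h0 hx hy hv)
    rw [hval]
    exact ⟨h1, h2, fun h => absurd hD h,
      fun _ => ⟨rfl, hf.tendsto_legendreFenchel hl hr hlr hD h0 hx⟩, h3⟩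
  · have hacc := h_acc hD
    obtain ⟨d, hd⟩ : ∃ d : ℝ, Function.rightLim (extRightDeriv (genLogMgf μ c)) l = d := by
      obtain ⟨m, hlm, hmr⟩ := exists_between hlr
      have hle := hf.rightLim_le_extRightDeriv hl hlm
      rw [hf.extRightDeriv_eq (hf.mem_interior_of_pos hr (hl.trans_lt hlm) hmr)] at hle
      exact ⟨_, (EReal.coe_toReal (hle.trans_lt (EReal.coe_lt_top _)).ne hD).symm⟩
    rw [hd] at hx hy hacc
    obtain ⟨V, hV, hV'⟩ := hf.exists_tendsto_tilted hl hr hlr hd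
    have hval : Function.rightLim (genLogMgf μ c) l - (l : EReal) * d = V := by
      rw [hf.rightLim_eq hl hr hlr hV]
      exact_mod_cast (by ring : V + l * d - l * d = V)
    obtain ⟨h1, h2, h3⟩ := limsup_eq_and_tendsto (V := V) hc_pos
      (e := affineSup (genLogMgf μ c) l) (x := x) (y := y)
      (fun v hv => eventually_scaledLogIcc_le_of_real_slope hc_pos hf hl hr hlr hV hx hv)
      (fun v hv => lowerBoundAt_of_real_slope hμ hc_pos hc hf hl hd hacc hV' hx hy hv)
    have hLF := hf.neg_legendreFenchel_eq hl hr hlr hV hV'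
    rw [hd, hval, hLF, hf.iInf_tilted_eq hl hr hlr hV hV']
    exact ⟨h1, h2, fun _ => ⟨rfl, rfl⟩, fun h => absurd h (EReal.coe_ne_bot d), h3⟩
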